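/- For a finite group $G$ and a symmetric subset $T=T^{-1}\subseteq G$, let $\operatorname{Cay}(G,T)$ be the Cayley graph with vertex set $G$ and edges $(g,gs)$ for all $g\in G$, $s\in T$ (with a loop at every vertex if $1\in T$). Write $\lambda_1\ge\lambda_2\ge\cdots$ for the eigenvalues of the adjacency matrix of a graph, listed in descending order with multiplicity. The spectral gap of the graph is $\lambda_1-\lambda_2$, and its second eigenvalue multiplicity is the number of times $\lambda_2$ appears in this list. **Theorem 2.1.** Let $\Gamma$ be a finite group, let $S=S^{-1}$ be a symmetric subset of $\Gamma$, and let $\Pi$ be the subgroup of $\Gamma$ generated by $S$. Suppose that $\operatorname{Cay}(\Pi,S)$ has spectral gap at least $4$, and that the set of double cosets $\Pi\backslash\Gamma/\Pi=\{\Pi g\Pi : g\in\Gamma\}$ has exactly two elements. Let $t\in\Gamma$ with $t\notin\Pi$ and $t\ne t^{-1}$. Then $\operatorname{Cay}(\Gamma,S\cup\{t,t^{-1}\})$ has second eigenvalue multiplicity at least $|\Gamma|/|\Pi|-1$. -/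

import Mathlib

open scoped Pointwise

noncomputable section

/-- The eigenvalues `λ₁ ≥ λ₂ ≥ ⋯` of a real square matrix, in descending order and repeated
according to multiplicity as roots of the characteristic polynomial. For a symmetric `n × n`
matrix this list has exactly `n` entries. -/
def eigenvalueList {V : Type*} [Finite V] (A : Matrix V V ℝ) : List ℝ :=
  letI := Fintype.ofFinite V
  letI := Classical.decEq V
  A.charpoly.roots.sort (· ≥ ·)

/-- The largest eigenvalue `λ₁`. -/
def firstEigenvalue {V : Type*} [Finite V] (A : Matrix V V ℝ) : ℝ :=
  (eigenvalueList A).getD 0 0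

/-- The second eigenvalue `λ₂`: the second entry of the descending list
(meaningful when there are at least two vertices). -/
def secondEigenvalue {V : Type*} [Finite V] (A : Matrix V V ℝ) : ℝ :=
  (eigenvalueList A).getD 1 0

/-- The spectral gap `λ₁ - λ₂`, not normalized by the degree. -/
def spectralGap {V : Type*} [Finite V] (A : Matrix V V ℝ) : ℝ :=
  firstEigenvalue A - secondEigenvalue A

/-- The number of times that `λ₂` occurs in the list of eigenvalues. -/
def secondEigenvalueMultiplicity {V : Type*} [Finite V] (A : Matrix V V ℝ) : ℕ :=
  (eigenvalueList A).count (secondEigenvalue A)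

open Classical in
/-- The adjacency matrix of the Cayley graph `Cay(G, S)`, which has vertex set `G` and the edges
`(g, g * s)` for `g ∈ G` and `s ∈ S`. If `1 ∈ S`, there is a loop at each vertex, recorded by a `1`
on the diagonal. -/
def cayleyAdjMatrix {G : Type*} [Group G] (S : Set G) : Matrix G G ℝ :=
  Matrix.of fun g h => if g⁻¹ * h ∈ S then 1 else 0

/-- If `S = S⁻¹` does not contain `1`, this is the adjacency matrix of Mathlib's Cayley graph. -/
theorem cayleyAdjMatrix_eq_adjMatrix {G : Type*} [Group G] {S : Set G} (hS : S⁻¹ = S)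
    (h1 : (1 : G) ∉ S) [DecidableRel (SimpleGraph.mulCayley S).Adj] :
    cayleyAdjMatrix S = (SimpleGraph.mulCayley S).adjMatrix ℝ := by
  ext g h
  have key : (SimpleGraph.mulCayley S).Adj g h ↔ g⁻¹ * h ∈ S := by
    rw [SimpleGraph.mulCayley_adj]
    constructor
    · rintro ⟨-, h' | h'⟩
      · exact h'
      · rw [← hS]
        simpa using h'
    · intro h'
      refine ⟨?_, Or.inl h'⟩
      rintro rfl
      exact h1 (by simpa using h')
  by_cases h' : g⁻¹ * h ∈ S
  · simp [cayleyAdjMatrix, SimpleGraph.adjMatrix_apply, h', key.2 h']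
  · simp [cayleyAdjMatrix, SimpleGraph.adjMatrix_apply, h', mt key.1 h']

/-- The adjacency matrix of `Cay(G, S)` with `S = S⁻¹` is symmetric. -/
theorem cayleyAdjMatrix_isSymm {G : Type*} [Group G] {S : Set G} (hS : S⁻¹ = S) :
    (cayleyAdjMatrix S).IsSymm := by
  ext g h
  have key : h⁻¹ * g ∈ S ↔ g⁻¹ * h ∈ S := by
    rw [← Set.inv_mem_inv, hS]
    simp
  by_cases h' : g⁻¹ * h ∈ S
  · simp [cayleyAdjMatrix, h', key.2 h']
  · simp [cayleyAdjMatrix, h', mt key.1 h']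

end

/-! Let `d = |S|` and let `λ₂` be the second eigenvalue of the large graph. Among functions with
zero sum on `Γ`, compare those constant on left cosets of `P` with those of zero sum on every left
coset. On the former, `S` acts as the scalar `d`; on the latter, the gap makes its Rayleigh quotient
at most `d - 4`. Adding `t` and `t⁻¹` changes a Rayleigh quotient by at most 2, so the two kinds are
separated by `d - 2`: the first has quotient at least `d - 2`, the second at most `d - 2`. Hence
some `λ₂`-eigenfunction of zero sum has a nonzero sum over some coset
(`exists_mem_secondEigenspace_sum_coset_ne_zero`).

The eigenspace is invariant under left translation, so summing over cosets maps it to a nonzero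
invariant space of zero-sum functions on `Γ ⧸ P`. Two double cosets mean that `Γ` acts
2-transitively on `Γ ⧸ P`, so the zero-sum functions there form an irreducible representation, of
dimension `[Γ : P] - 1`, and the image is all of it. `index_le_finrank_add_one` proves this by hand.
-/

/-! ### Variational description of the second eigenvalue -/

open Matrix in
/-- The spectral theorem for a real symmetric matrix, in terms of `eigenvalueList`. -/
theorem exists_eigenbasis {V : Type*} [Fintype V] {A : Matrix V V ℝ} (hA : A.IsSymm)
    (hV : 2 ≤ Fintype.card V) :
    ∃ (μ : V → ℝ) (e : V → V → ℝ) (i₀ i₁ : V), i₀ ≠ i₁ ∧ (∀ i, A *ᵥ e i = μ i • e i) ∧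
      (∀ i, e i ⬝ᵥ e i = 1) ∧ (∀ i j, i ≠ j → e i ⬝ᵥ e j = 0) ∧
      (∀ f g, f ⬝ᵥ g = ∑ i, (e i ⬝ᵥ f) * (e i ⬝ᵥ g)) ∧
      μ i₀ = firstEigenvalue A ∧ μ i₁ = secondEigenvalue A ∧
      (∀ i, i ≠ i₀ → μ i ≤ μ i₁) ∧ μ i₁ ≤ μ i₀ := by
  classical
  have hH : A.IsHermitian := by
    rw [Matrix.IsHermitian, Matrix.conjTranspose_eq_transpose_of_trivial]; exact hA
  have hlist : eigenvalueList A = List.ofFn hH.eigenvalues₀ := by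
    rw [← hH.sort_roots_charpoly_eq_eigenvalues₀]
    unfold eigenvalueList
    simp only [RCLike.re_to_real, Multiset.map_id']
    congr!
  set σ : Fin (Fintype.card V) ≃ V := Fintype.equivOfCardEq (Fintype.card_fin _) with hσ
  have hμ : ∀ k, hH.eigenvalues (σ k) = hH.eigenvalues₀ k := fun k => by
    simp [Matrix.IsHermitian.eigenvalues, hσ]
  have hdot : ∀ x y : EuclideanSpace ℝ V, (x : V → ℝ) ⬝ᵥ (y : V → ℝ) = inner ℝ x y := by
    intro x y
    simp [PiLp.inner_apply, dotProduct, mul_comm]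
  have horth := hH.eigenvectorBasis.orthonormal
  refine ⟨hH.eigenvalues, fun i => hH.eigenvectorBasis i, σ ⟨0, by omega⟩, σ ⟨1, by omega⟩,
    ?_, hH.mulVec_eigenvectorBasis, ?_, ?_, ?_, ?_, ?_, ?_, ?_⟩
  · simp
  · intro i
    rw [hdot, real_inner_self_eq_norm_sq, horth.1 i, one_pow]
  · intro i j hij
    rw [hdot, horth.2 hij]
  · intro f g
    have h := hH.eigenvectorBasis.sum_inner_mul_inner (WithLp.toLp 2 f) (WithLp.toLp 2 g)
    have h1 := hdot (WithLp.toLp 2 f) (WithLp.toLp 2 g)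
    simp only at h1
    rw [h1, ← h]
    refine Finset.sum_congr rfl fun i _ => ?_
    rw [real_inner_comm, ← hdot, ← hdot]
  · rw [hμ, firstEigenvalue, hlist, List.getD_eq_getElem _ _ (by simp; omega)]; simp
  · rw [hμ, secondEigenvalue, hlist, List.getD_eq_getElem _ _ (by simp; omega)]; simp
  · intro i hi
    obtain ⟨k, rfl⟩ := σ.surjective i
    rw [hμ, hμ]
    refine hH.eigenvalues₀_antitone ?_
    have : k.1 ≠ 0 := fun h => hi (congrArg σ (Fin.ext h))
    rw [Fin.le_def]; simp; omega
  · rw [hμ, hμ]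
    exact hH.eigenvalues₀_antitone (by rw [Fin.le_def]; simp)

open Matrix in
/-- A symmetric matrix whose Rayleigh quotient is maximal at the constant functions has its
maximal Rayleigh quotient on the functions with zero sum equal to the second eigenvalue. -/
theorem secondEigenvalue_variational {V : Type*} [Fintype V] {A : Matrix V V ℝ} (hA : A.IsSymm)
    (hV : 2 ≤ Fintype.card V) {d : ℝ} (h1 : A *ᵥ 1 = d • 1)
    (hd : ∀ f, f ⬝ᵥ A *ᵥ f ≤ d * (f ⬝ᵥ f)) :
    firstEigenvalue A = d ∧
      (∀ f, f ⬝ᵥ 1 = 0 → f ⬝ᵥ A *ᵥ f ≤ secondEigenvalue A * (f ⬝ᵥ f)) ∧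
      ∃ f, f ≠ 0 ∧ f ⬝ᵥ 1 = 0 ∧ A *ᵥ f = secondEigenvalue A • f := by
  classical
  obtain ⟨μ, e, i₀, i₁, hne, hAe, hnorm, horth, hpars, h₀, h₁, hle, hle₀⟩ :=
    exists_eigenbasis hA hV
  rw [← h₀, ← h₁]
  have heA : ∀ i f, e i ⬝ᵥ A *ᵥ f = μ i * (e i ⬝ᵥ f) := by
    intro i f
    rw [dotProduct_mulVec, ← mulVec_transpose, hA.eq, hAe, smul_dotProduct, smul_eq_mul]
  have hray : ∀ f, f ⬝ᵥ A *ᵥ f = ∑ i, μ i * (e i ⬝ᵥ f) ^ 2 := by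
    intro f
    rw [hpars]
    exact Finset.sum_congr rfl fun i _ => by rw [heA]; ring
  have hsq : ∀ f, f ⬝ᵥ f = ∑ i, (e i ⬝ᵥ f) ^ 2 := by
    intro f
    rw [hpars]
    exact Finset.sum_congr rfl fun i _ => by ring
  have hne0 : ∀ i, e i ≠ 0 := fun i h => by simpa [h] using hnorm i
  have hcard : (0 : ℝ) < (1 : V → ℝ) ⬝ᵥ 1 := by
    simp only [dotProduct, Pi.one_apply, mul_one, Finset.sum_const, Finset.card_univ,
      nsmul_eq_mul]
    exact_mod_cast (by omega : 0 < Fintype.card V)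
  have hmax : μ i₀ = d := by
    apply le_antisymm
    · simpa [hAe, hnorm] using hd (e i₀)
    · have h := hray 1
      rw [h1, dotProduct_smul, smul_eq_mul] at h
      have h' : ∑ i, μ i * (e i ⬝ᵥ 1) ^ 2 ≤ μ i₀ * ((1 : V → ℝ) ⬝ᵥ 1) := by
        rw [hsq, Finset.mul_sum]
        refine Finset.sum_le_sum fun i _ => mul_le_mul_of_nonneg_right ?_ (sq_nonneg _)
        by_cases hi : i = i₀
        · rw [hi]
        · exact (hle i hi).trans hle₀
      rw [← h] at h'
      exact le_of_mul_le_mul_right h' hcard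
  refine ⟨hmax, ?_⟩
  by_cases heq : μ i₁ = d
  · rw [heq]
    refine ⟨fun f _ => hd f, ?_⟩
    by_cases hi : e i₁ ⬝ᵥ 1 = 0
    · exact ⟨e i₁, hne0 _, hi, by rw [hAe, heq]⟩
    -- Both vectors have eigenvalue `d`; this combination cancels their sums.
    · refine ⟨(e i₁ ⬝ᵥ 1) • e i₀ - (e i₀ ⬝ᵥ 1) • e i₁, ?_, ?_, ?_⟩
      · intro h
        have h' := congrArg (fun f => e i₀ ⬝ᵥ f) h
        simp only [dotProduct_sub, dotProduct_smul, hnorm, horth _ _ hne, dotProduct_zero,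
          smul_eq_mul] at h'
        exact hi (by linarith)
      · simp only [sub_dotProduct, smul_dotProduct, smul_eq_mul]
        ring
      · rw [mulVec_sub, mulVec_smul, mulVec_smul, hAe, hAe, heq, hmax, smul_sub, smul_comm d,
          smul_comm d]
  · have hlt : μ i₁ < d := lt_of_le_of_ne (hmax ▸ hle₀) heq
    -- Now `d` is a simple eigenvalue, so the constants lie along `e i₀`.
    have hz : ∀ i, i ≠ i₀ → e i ⬝ᵥ 1 = 0 := by
      intro i hi
      have h := heA i 1
      rw [h1, dotProduct_smul, smul_eq_mul] at h
      have h2 : (d - μ i) * (e i ⬝ᵥ 1) = 0 := by linarith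
      rcases mul_eq_zero.1 h2 with h3 | h3
      · linarith [hle i hi]
      · exact h3
    refine ⟨fun f hf => ?_, e i₁, hne0 _, hz _ hne.symm, hAe _⟩
    have hsingle : ∀ g, g ⬝ᵥ 1 = (e i₀ ⬝ᵥ g) * (e i₀ ⬝ᵥ 1) := by
      intro g
      rw [hpars, Finset.sum_eq_single i₀]
      · intro i _ hi
        rw [hz i hi, mul_zero]
      · simp
    have hf0 : e i₀ ⬝ᵥ f = 0 := by
      have h2 := hsingle f
      rw [hf] at h2
      rcases mul_eq_zero.1 h2.symm with h3 | h3
      · exact h3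
      · rw [hsingle, h3, mul_zero] at hcard
        exact absurd hcard (lt_irrefl _)
    rw [hray, hsq, Finset.mul_sum]
    refine Finset.sum_le_sum fun i _ => ?_
    by_cases hi : i = i₀
    · rw [hi, hf0]; simp
    · exact mul_le_mul_of_nonneg_right (hle i hi) (sq_nonneg _)

open Matrix in
/-- A maximizer of the Rayleigh quotient on an invariant subspace is an eigenvector. -/
theorem mulVec_eq_smul_of_rayleigh {V : Type*} [Fintype V] {A : Matrix V V ℝ} (hA : A.IsSymm)
    {d μ : ℝ} (h1 : A *ᵥ 1 = d • 1)
    (hμ : ∀ f, f ⬝ᵥ 1 = 0 → f ⬝ᵥ A *ᵥ f ≤ μ * (f ⬝ᵥ f)) {f : V → ℝ} (hf : f ⬝ᵥ 1 = 0)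
    (hfμ : μ * (f ⬝ᵥ f) ≤ f ⬝ᵥ A *ᵥ f) : A *ᵥ f = μ • f := by
  have hcomm : ∀ x y : V → ℝ, x ⬝ᵥ A *ᵥ y = y ⬝ᵥ A *ᵥ x := by
    intro x y
    rw [dotProduct_mulVec, ← mulVec_transpose, hA.eq, dotProduct_comm]
  set g : V → ℝ := A *ᵥ f - μ • f with hg
  have hg1 : g ⬝ᵥ 1 = 0 := by
    rw [hg, sub_dotProduct, smul_dotProduct, hf, dotProduct_comm, hcomm, h1, dotProduct_smul, hf]
    simp
  have hgg : g ⬝ᵥ g = g ⬝ᵥ A *ᵥ f - μ * (g ⬝ᵥ f) := by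
    conv_lhs => rw [hg, dotProduct_sub, dotProduct_smul, smul_eq_mul, ← hg]
  have hnonneg : 0 ≤ g ⬝ᵥ g := by
    rw [dotProduct]; exact Finset.sum_nonneg fun i _ => mul_self_nonneg _
  -- Perturb `f` along the residual `g`: the linear gain must be absorbed by the quadratic loss.
  have key : ∀ ε : ℝ, 2 * ε * (g ⬝ᵥ g) ≤ ε ^ 2 * (μ * (g ⬝ᵥ g) - g ⬝ᵥ A *ᵥ g) := by
    intro ε
    have h := hμ (f + ε • g) (by rw [add_dotProduct, smul_dotProduct, hf, hg1]; simp)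
    simp only [mulVec_add, mulVec_smul, add_dotProduct, dotProduct_add, smul_dotProduct,
      dotProduct_smul, smul_eq_mul, hcomm f g, dotProduct_comm f g] at h
    have h2 : 2 * ε * (g ⬝ᵥ g) = 2 * ε * (g ⬝ᵥ A *ᵥ f - μ * (g ⬝ᵥ f)) := by rw [← hgg]
    linarith
  have hzero : g ⬝ᵥ g = 0 := by
    by_contra hne
    have hpos : 0 < g ⬝ᵥ g := lt_of_le_of_ne hnonneg (Ne.symm hne)
    set c := μ * (g ⬝ᵥ g) - g ⬝ᵥ A *ᵥ g
    have hc : 0 ≤ c := sub_nonneg.2 (hμ g hg1)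
    -- A step small enough for the linear term to win; the `+ 1` covers `c = 0`.
    have h := key ((g ⬝ᵥ g) / (c + 1))
    have h2 : 2 * ((g ⬝ᵥ g) / (c + 1)) * (g ⬝ᵥ g) - ((g ⬝ᵥ g) / (c + 1)) ^ 2 * c
        = (g ⬝ᵥ g) ^ 2 * (c + 2) / (c + 1) ^ 2 := by
      field_simp
      ring
    have h3 : 0 < (g ⬝ᵥ g) ^ 2 * (c + 2) / (c + 1) ^ 2 := by positivity
    linarith
  exact sub_eq_zero.1 (dotProduct_self_eq_zero.1 hzero)

/-- The multiplicity of `λ₂` is at least the dimension of any subspace of its eigenspace. -/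
theorem finrank_le_secondEigenvalueMultiplicity {V : Type*} [Fintype V] {A : Matrix V V ℝ}
    {W : Submodule ℝ (V → ℝ)} (hW : ∀ f ∈ W, A.mulVec f = secondEigenvalue A • f) :
    Module.finrank ℝ W ≤ secondEigenvalueMultiplicity A := by
  classical
  have hle : W ≤ Module.End.eigenspace (Matrix.toLin' A) (secondEigenvalue A) := fun f hf => by
    rw [Module.End.mem_eigenspace_iff, Matrix.toLin'_apply, hW f hf]
  refine (Submodule.finrank_mono hle).trans ((LinearMap.finrank_eigenspace_le _ _).trans_eq ?_)
  rw [Matrix.charpoly_toLin', ← Polynomial.count_roots, secondEigenvalueMultiplicity,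
    eigenvalueList, ← Multiset.coe_count, Multiset.sort_eq]
  congr!
-- Double cosets and functions on left cosets
/-- If there are exactly two double cosets, then the complement of the subgroup is one of them. -/
theorem exists_mul_mul_eq_of_card_doubleCoset_eq_two {G : Type*} [Group G] {P : Subgroup G}
    (hcosets : Nat.card (DoubleCoset.Quotient (P : Set G) (P : Set G)) = 2) {g h : G}
    (hg : g ∉ P) (hh : h ∉ P) : ∃ p ∈ P, ∃ q ∈ P, h = p * g * q := by
  rw [← DoubleCoset.eq]
  have hne : ∀ x, x ∉ P → DoubleCoset.mk P P x ≠ DoubleCoset.mk P P 1 := by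
    intro x hx h1
    obtain ⟨p, hp, q, hq, h2⟩ := (DoubleCoset.eq P P x 1).1 h1
    apply hx
    have : x = p⁻¹ * q⁻¹ := by
      rw [eq_comm, mul_assoc, ← eq_inv_mul_iff_mul_eq, mul_one, ← eq_mul_inv_iff_mul_eq] at h2
      exact h2
    rw [this]
    exact mul_mem (inv_mem hp) (inv_mem hq)
  obtain ⟨x, y, hxy, huniv⟩ := Nat.card_eq_two_iff.1 hcosets
  have hmem : ∀ z, z = x ∨ z = y := fun z => by
    have : z ∈ ({x, y} : Set _) := huniv ▸ Set.mem_univ z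
    simpa using this
  rcases hmem (DoubleCoset.mk P P 1) with h1 | h1 <;>
    rcases hmem (DoubleCoset.mk P P g) with h2 | h2 <;>
    rcases hmem (DoubleCoset.mk P P h) with h3 | h3 <;>
    first
    | exact h2.trans h3.symm
    | exact absurd (h2.trans h1.symm) (hne g hg)
    | exact absurd (h3.trans h1.symm) (hne h hh)

/-- A space of functions on `G` containing the constants and all indicators of left cosets of `P`
has dimension at least the index of `P`. -/
theorem index_le_finrank_of_indicator_mem {G : Type*} [Group G] [Finite G] {P : Subgroup G}
    {X : Submodule ℝ (G → ℝ)}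
    (hX : ∀ g : G, (P : Set G).indicator (1 : G → ℝ) ∘ (g⁻¹ * ·) ∈ X) :
    P.index ≤ Module.finrank ℝ X := by
  classical
  have := Fintype.ofFinite (G ⧸ P)
  let φ : (G ⧸ P → ℝ) →ₗ[ℝ] (G → ℝ) := LinearMap.funLeft ℝ ℝ (QuotientGroup.mk : G → G ⧸ P)
  have hφ : Function.Injective φ :=
    LinearMap.funLeft_injective_of_surjective ℝ ℝ _ QuotientGroup.mk_surjective
  have hrange : LinearMap.range φ ≤ X := by
    rintro _ ⟨f, rfl⟩
    have hf : f = ∑ q, f q • Pi.single q (1 : ℝ) := by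
      ext q
      simp [Finset.sum_apply, Pi.single_apply]
    rw [hf, map_sum]
    refine Submodule.sum_mem _ fun q _ => ?_
    rw [map_smul]
    refine X.smul_mem _ ?_
    obtain ⟨g, rfl⟩ := QuotientGroup.mk_surjective q
    convert hX g using 1
    ext x
    have : (QuotientGroup.mk x : G ⧸ P) = QuotientGroup.mk g ↔ g⁻¹ * x ∈ P := by
      rw [eq_comm, QuotientGroup.eq]
    simp [φ, LinearMap.funLeft_apply, Pi.single_apply, Set.indicator_apply, this]
  calc P.index = Module.finrank ℝ (G ⧸ P → ℝ) := by
        rw [Module.finrank_fintype_fun_eq_card, Subgroup.index, Nat.card_eq_fintype_card]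
    _ = Module.finrank ℝ (LinearMap.range φ) := (LinearMap.finrank_range_of_inj hφ).symm
    _ ≤ Module.finrank ℝ X := Submodule.finrank_mono hrange

/-- A left-invariant space of functions with zero sum on `G`, one of which has nonzero sum over
some left coset of `P`, has dimension at least `[G : P] - 1` if there are two double cosets. -/
theorem index_le_finrank_add_one {G : Type*} [Group G] [Fintype G] {P : Subgroup G} [Fintype P]
    (hcosets : Nat.card (DoubleCoset.Quotient (P : Set G) (P : Set G)) = 2)
    {t : G} (ht : t ∉ P) {W : Submodule ℝ (G → ℝ)}
    (hW : ∀ f ∈ W, ∀ g, (fun x => f (g * x)) ∈ W) (hsum : ∀ f ∈ W, ∑ x, f x = 0)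
    {f : G → ℝ} (hf : f ∈ W) {x₀ : G} (hne : ∑ p : P, f (x₀ * p) ≠ 0) :
    P.index ≤ Module.finrank ℝ W + 1 := by
  classical
  let avg : (G → ℝ) →ₗ[ℝ] (G → ℝ) := ∑ p : P, LinearMap.funLeft ℝ ℝ (fun x : G => x * p)
  have havg : ∀ f x, avg f x = ∑ p : P, f (x * p) := by
    intro f x
    simp [avg, LinearMap.sum_apply, Finset.sum_apply, LinearMap.funLeft_apply]
  let X := W.map avg
  have hXle : Module.finrank ℝ X ≤ Module.finrank ℝ W := Submodule.finrank_map_le _ _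
  have hX : ∀ F ∈ X, ∀ g, (fun x => F (g * x)) ∈ X := by
    rintro _ ⟨u, hu, rfl⟩ g
    refine ⟨_, hW u hu g, ?_⟩
    ext x
    simp only [havg, mul_assoc]
  have hXP : ∀ F ∈ X, ∀ x, ∀ q ∈ P, F (x * q) = F x := by
    rintro _ ⟨u, hu, rfl⟩ x q hq
    simp only [havg]
    refine Fintype.sum_equiv (Equiv.mulLeft (⟨q, hq⟩ : P)) _ _ fun p => ?_
    simp [mul_assoc]
  have hXsum : ∀ F ∈ X, ∑ x, F x = 0 := by
    rintro _ ⟨u, hu, rfl⟩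
    simp only [havg]
    rw [Finset.sum_comm]
    refine Finset.sum_eq_zero fun p _ => ?_
    rw [← hsum u hu]
    exact Fintype.sum_equiv (Equiv.mulRight (p : G)) _ _ fun x => rfl
  -- Translate so that the coset with nonzero sum becomes `P` itself.
  let F : G → ℝ := fun x => avg f (x₀ * x)
  have hF : F ∈ X := hX _ (Submodule.mem_map_of_mem hf) x₀
  have hF1 : F 1 ≠ 0 := by simpa [F, havg] using hne
  -- Averaging on the left gives a `P`-bi-invariant function, which takes one value on `P` and one
  -- off it.
  let H : G → ℝ := fun x => ∑ p : P, F (p * x)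
  have hH : H ∈ X := by
    have : H = ∑ p : P, fun x => F (p * x) := by ext x; simp [H]
    rw [this]
    exact Submodule.sum_mem _ fun p _ => hX F hF p
  have hHP : ∀ p ∈ P, ∀ x, H (p * x) = H x := by
    intro q hq x
    refine Fintype.sum_equiv (Equiv.mulRight (⟨q, hq⟩ : P)) _ _ fun p => ?_
    simp [mul_assoc]
  have hHin : ∀ x ∈ P, H x = H 1 := fun x hx => by simpa using hHP x hx 1
  have hHout : ∀ x, x ∉ P → H x = H t := by
    intro x hx
    obtain ⟨p, hp, q, hq, rfl⟩ := exists_mul_mul_eq_of_card_doubleCoset_eq_two hcosets ht hx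
    rw [hXP H hH _ q hq, hHP p hp]
  have hH1 : H 1 ≠ 0 := by
    have : H 1 = Fintype.card P * F 1 := by
      have h : ∀ p : P, F (p * 1) = F 1 := fun p => by
        have h2 := hXP F hF 1 p p.2
        rwa [one_mul, ← mul_one (p : G)] at h2
      simp only [H, h]
      simp
    rw [this]
    exact mul_ne_zero (by exact_mod_cast Fintype.card_ne_zero) hF1
  -- Equal values would make `H` a nonzero constant, against its zero sum.
  have hab : H 1 - H t ≠ 0 := by
    intro h
    have hconst : ∀ x, H x = H 1 := by
      intro x
      by_cases hx : x ∈ P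
      · exact hHin x hx
      · rw [hHout x hx]; linarith
    have h0 := hXsum H hH
    simp only [hconst, Finset.sum_const, Finset.card_univ, nsmul_eq_mul] at h0
    rcases mul_eq_zero.1 h0 with h2 | h2
    · exact absurd h2 (by exact_mod_cast Fintype.card_ne_zero)
    · exact hH1 h2
  have hind : ∀ g : G, (P : Set G).indicator (1 : G → ℝ) ∘ (g⁻¹ * ·) ∈
      X ⊔ Submodule.span ℝ {(1 : G → ℝ)} := by
    intro g
    have heq : (P : Set G).indicator (1 : G → ℝ) ∘ (g⁻¹ * ·) =
        (H 1 - H t)⁻¹ • (fun x => H (g⁻¹ * x)) + (-((H 1 - H t)⁻¹ * H t)) • (1 : G → ℝ) := by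
      ext x
      by_cases hx : g⁻¹ * x ∈ P
      · simp only [Function.comp_apply, Pi.add_apply, Pi.smul_apply, smul_eq_mul, Pi.one_apply,
          Set.indicator_of_mem (s := (P : Set G)) hx, hHin _ hx]
        field_simp
        ring
      · simp only [Function.comp_apply, Pi.add_apply, Pi.smul_apply, smul_eq_mul, Pi.one_apply,
          Set.indicator_of_notMem (s := (P : Set G)) hx, hHout _ hx]
        ring
    rw [heq]
    exact add_mem (Submodule.mem_sup_left (X.smul_mem _ (hX H hH _)))
      (Submodule.mem_sup_right (Submodule.smul_mem _ _ (Submodule.mem_span_singleton_self _)))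
  calc P.index ≤ Module.finrank ℝ ↥(X ⊔ Submodule.span ℝ {(1 : G → ℝ)}) :=
        index_le_finrank_of_indicator_mem hind
    _ ≤ Module.finrank ℝ X + Module.finrank ℝ (Submodule.span ℝ {(1 : G → ℝ)}) :=
        Submodule.finrank_add_le_finrank_add_finrank _ _
    _ ≤ Module.finrank ℝ W + 1 := add_le_add hXle (finrank_span_singleton one_ne_zero).le
-- Quadratic forms of Cayley graphs
open Matrix in
/-- The adjacency operator of a Cayley graph. -/
theorem cayleyAdjMatrix_mulVec {G : Type*} [Group G] [Fintype G] (T : Set G) (f : G → ℝ) (g : G) :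
    (cayleyAdjMatrix T *ᵥ f) g = ∑ s, T.indicator 1 s * f (g * s) := by
  classical
  rw [mulVec, dotProduct]
  refine (Fintype.sum_equiv (Equiv.mulLeft g) _ _ fun s => ?_).symm
  simp [cayleyAdjMatrix, Set.indicator_apply]

open Matrix in
/-- The quadratic form of a Cayley graph in terms of the autocorrelation of a function. -/
theorem dotProduct_cayleyAdjMatrix_mulVec {G : Type*} [Group G] [Fintype G] (T : Set G)
    (f : G → ℝ) :
    f ⬝ᵥ cayleyAdjMatrix T *ᵥ f = ∑ s, T.indicator 1 s * ∑ g, f g * f (g * s) := by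
  simp only [dotProduct, cayleyAdjMatrix_mulVec, Finset.mul_sum]
  rw [Finset.sum_comm]
  exact Finset.sum_congr rfl fun s _ => Finset.sum_congr rfl fun g _ => by ring

open Matrix in
theorem cayleyAdjMatrix_mulVec_one {G : Type*} [Group G] [Fintype G] (T : Set G) :
    cayleyAdjMatrix T *ᵥ 1 = (∑ s, T.indicator (1 : G → ℝ) s) • (1 : G → ℝ) := by
  ext g
  simp [cayleyAdjMatrix_mulVec]

theorem dotProduct_comp_mul_right {G : Type*} [Group G] [Fintype G] (f : G → ℝ) (s : G) :
    ∑ g, f (g * s) * f (g * s) = f ⬝ᵥ f :=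
  Fintype.sum_equiv (Equiv.mulRight s) _ _ fun _ => rfl

/-- The autocorrelation of a function is at most its squared norm. -/
theorem autocorrelation_le {G : Type*} [Group G] [Fintype G] (f : G → ℝ) (s : G) :
    ∑ g, f g * f (g * s) ≤ f ⬝ᵥ f := by
  have h : ∑ g, f g * f (g * s) ≤ ∑ g, (f g * f g + f (g * s) * f (g * s)) / 2 :=
    Finset.sum_le_sum fun g _ => by nlinarith [sq_nonneg (f g - f (g * s))]
  rw [← Finset.sum_div, Finset.sum_add_distrib, dotProduct_comp_mul_right] at h
  have : ∑ g, f g * f g = f ⬝ᵥ f := rfl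
  linarith

/-- Bounds by 1 how much a new generator can lower a Rayleigh quotient. -/
theorem neg_le_autocorrelation {G : Type*} [Group G] [Fintype G] (f : G → ℝ) (s : G) :
    -(f ⬝ᵥ f) ≤ ∑ g, f g * f (g * s) := by
  have h : ∑ g, -((f g * f g + f (g * s) * f (g * s)) / 2) ≤ ∑ g, f g * f (g * s) :=
    Finset.sum_le_sum fun g _ => by nlinarith [sq_nonneg (f g + f (g * s))]
  rw [Finset.sum_neg_distrib, ← Finset.sum_div, Finset.sum_add_distrib,
    dotProduct_comp_mul_right] at h
  have : ∑ g, f g * f g = f ⬝ᵥ f := rfl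
  linarith

open Matrix in
theorem dotProduct_cayleyAdjMatrix_mulVec_le {G : Type*} [Group G] [Fintype G] (T : Set G)
    (f : G → ℝ) :
    f ⬝ᵥ cayleyAdjMatrix T *ᵥ f ≤ (∑ s, T.indicator (1 : G → ℝ) s) * (f ⬝ᵥ f) := by
  rw [dotProduct_cayleyAdjMatrix_mulVec, Finset.sum_mul]
  exact Finset.sum_le_sum fun s _ => mul_le_mul_of_nonneg_left (autocorrelation_le f s)
    (Set.indicator_nonneg (fun _ _ => zero_le_one) s)

/-- The spectral properties of the Cayley graph of a nontrivial group. -/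
theorem cayleyAdjMatrix_secondEigenvalue_variational {G : Type*} [Group G] [Fintype G]
    {T : Set G} (hT : T⁻¹ = T) (hG : 2 ≤ Fintype.card G) :
    firstEigenvalue (cayleyAdjMatrix T) = ∑ s, T.indicator (1 : G → ℝ) s ∧
      (∀ f, f ⬝ᵥ 1 = 0 → f ⬝ᵥ (cayleyAdjMatrix T).mulVec f ≤
        secondEigenvalue (cayleyAdjMatrix T) * (f ⬝ᵥ f)) ∧
      ∃ f, f ≠ 0 ∧ f ⬝ᵥ 1 = 0 ∧
        (cayleyAdjMatrix T).mulVec f = secondEigenvalue (cayleyAdjMatrix T) • f :=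
  secondEigenvalue_variational (cayleyAdjMatrix_isSymm hT) hG (cayleyAdjMatrix_mulVec_one T)
    (dotProduct_cayleyAdjMatrix_mulVec_le T)

/-- A Cayley graph of the trivial group has spectral gap at most one, by the convention that a
missing eigenvalue is zero. -/
theorem spectralGap_cayleyAdjMatrix_le_one_of_subsingleton {G : Type*} [Group G] [Subsingleton G]
    (T : Set G) : spectralGap (cayleyAdjMatrix T) ≤ 1 := by
  classical
  have : Unique G := ⟨⟨1⟩, fun x => Subsingleton.elim x 1⟩
  set A := cayleyAdjMatrix T with hA
  have hchar : ∀ (_ : Fintype G) (_ : DecidableEq G),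
      A.charpoly = Polynomial.X - Polynomial.C (A 1 1) := by
    intro _ _
    have hdiag : A = Matrix.diagonal fun _ => A 1 1 := by
      ext i j
      rw [Subsingleton.elim i 1, Subsingleton.elim j 1, Matrix.diagonal_apply_eq]
    conv_lhs => rw [hdiag]
    rw [Matrix.charpoly_diagonal, Finset.prod_const, Finset.card_univ,
      Fintype.card_eq_one_iff_nonempty_unique.2 ⟨inferInstance⟩, pow_one]
  have hlist : eigenvalueList A = [A 1 1] := by
    rw [eigenvalueList, hchar, Polynomial.roots_X_sub_C, Multiset.sort_singleton]
  have h1 : A 1 1 ≤ 1 := by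
    simp only [hA, cayleyAdjMatrix, Matrix.of_apply]
    split_ifs <;> norm_num
  -- The list has one entry, so `secondEigenvalue` is its default 0.
  simpa [spectralGap, firstEigenvalue, secondEigenvalue, hlist] using h1

/-! ### Restriction to the subgroup -/

/-- A sum over a subset of a subgroup is a sum over the subgroup. -/
theorem sum_indicator_mul_eq_sum_subgroup {G : Type*} [Group G] [Fintype G] {P : Subgroup G}
    [Fintype P] {S : Set G} (hSP : S ⊆ P) (F : G → ℝ) :
    ∑ s, S.indicator 1 s * F s = ∑ s : P, {s : P | (s : G) ∈ S}.indicator 1 s * F s := by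
  classical
  refine (Finset.sum_of_injOn (fun s : P => (s : G)) Subtype.val_injective.injOn (by simp)
    ?_ ?_).symm
  · intro s _ hs
    have : s ∉ S := fun h => hs ⟨⟨s, hSP h⟩, by simp⟩
    simp [this]
  · intro s _
    simp [Set.indicator_apply]

/-- The quadratic form of `S` as the average of the quadratic forms on the left cosets of `P`. -/
theorem sum_dotProduct_cayleyAdjMatrix_subgroup {G : Type*} [Group G] [Fintype G] {P : Subgroup G}
    [Fintype P] {S : Set G} (hSP : S ⊆ P) (f : G → ℝ) :
    ∑ x, (fun p : P => f (x * p)) ⬝ᵥ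
        (cayleyAdjMatrix {s : P | (s : G) ∈ S}).mulVec (fun p : P => f (x * p)) =
      Fintype.card P * (f ⬝ᵥ (cayleyAdjMatrix S).mulVec f) := by
  simp only [dotProduct_cayleyAdjMatrix_mulVec]
  rw [sum_indicator_mul_eq_sum_subgroup hSP, Finset.sum_comm, Finset.mul_sum]
  refine Finset.sum_congr rfl fun s _ => ?_
  rw [← Finset.mul_sum, Finset.sum_comm]
  have h : ∀ p : P, ∑ x, f (x * p) * f (x * (p * s : P)) = ∑ x, f x * f (x * s) := fun p =>
    Fintype.sum_equiv (Equiv.mulRight (p : G)) _ _ fun x => by simp [mul_assoc]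
  simp only [h, Finset.sum_const, Finset.card_univ, nsmul_eq_mul]
  ring

theorem sum_dotProduct_comp_subgroup {G : Type*} [Group G] [Fintype G] {P : Subgroup G}
    [Fintype P] (f : G → ℝ) :
    ∑ x, (fun p : P => f (x * p)) ⬝ᵥ (fun p : P => f (x * p)) = Fintype.card P * (f ⬝ᵥ f) := by
  simp only [dotProduct]
  rw [Finset.sum_comm]
  have h : ∀ p : P, ∑ x, f (x * p) * f (x * p) = ∑ x, f x * f x := fun p =>
    dotProduct_comp_mul_right f p
  simp [h]

theorem inv_preimage_subgroup_eq {G : Type*} [Group G] {S : Set G} (hS : S⁻¹ = S)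
    (P : Subgroup G) : {s : P | (s : G) ∈ S}⁻¹ = {s : P | (s : G) ∈ S} := by
  ext s
  rw [Set.mem_inv, Set.mem_ofPred_eq, Set.mem_ofPred_eq, Subgroup.coe_inv, ← Set.mem_inv, hS]

/-- On functions with zero sum over the left cosets of `P`, the Rayleigh quotient of `S ⊆ P` is at
most the second eigenvalue of the Cayley graph on `P`. -/
theorem dotProduct_cayleyAdjMatrix_le_of_sum_coset_eq_zero {G : Type*} [Group G] [Fintype G]
    {P : Subgroup G} [Fintype P] {S : Set G} (hS : S⁻¹ = S) (hSP : S ⊆ P)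
    (hP : 2 ≤ Fintype.card P) {f : G → ℝ} (hf : ∀ x, ∑ p : P, f (x * p) = 0) :
    f ⬝ᵥ (cayleyAdjMatrix S).mulVec f ≤
      secondEigenvalue (cayleyAdjMatrix {s : P | (s : G) ∈ S}) * (f ⬝ᵥ f) := by
  have hS' := inv_preimage_subgroup_eq hS P
  obtain ⟨-, h, -⟩ := cayleyAdjMatrix_secondEigenvalue_variational hS' hP
  have hsum := Finset.sum_le_sum fun x (_ : x ∈ Finset.univ) =>
    h (fun p : P => f (x * p)) (by simpa [dotProduct] using hf x)
  rw [sum_dotProduct_cayleyAdjMatrix_subgroup hSP, ← Finset.mul_sum,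
    sum_dotProduct_comp_subgroup, mul_left_comm] at hsum
  exact le_of_mul_le_mul_left hsum (by exact_mod_cast Fintype.card_pos)

/-- The effect on the quadratic form of adding a pair of generators. -/
theorem dotProduct_cayleyAdjMatrix_union_pair {G : Type*} [Group G] [Fintype G] {S : Set G}
    {t u : G} (ht : t ∉ S) (hu : u ∉ S) (htu : t ≠ u) (f : G → ℝ) :
    f ⬝ᵥ (cayleyAdjMatrix (S ∪ {t, u})).mulVec f =
      f ⬝ᵥ (cayleyAdjMatrix S).mulVec f + ∑ g, f g * f (g * t) + ∑ g, f g * f (g * u) := by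
  classical
  have h : (S ∪ {t, u}).indicator (1 : G → ℝ) =
      S.indicator 1 + Pi.single t 1 + Pi.single u 1 := by
    ext s
    by_cases h1 : s = t
    · subst h1; simp [ht, htu]
    · by_cases h2 : s = u
      · subst h2; simp [hu, Ne.symm htu]
      · simp [Set.indicator_apply, h1, h2]
  simp only [dotProduct_cayleyAdjMatrix_mulVec, h, Pi.add_apply, add_mul, Finset.sum_add_distrib,
    Pi.single_apply, ite_mul, one_mul, zero_mul, Finset.sum_ite_eq',
    Finset.mem_univ, if_true]

/-- A function that is constant on the left cosets of `P` is an eigenvector for `S ⊆ P`. -/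
theorem cayleyAdjMatrix_mulVec_of_right_invariant {G : Type*} [Group G] [Fintype G]
    {P : Subgroup G} {S : Set G} (hSP : S ⊆ P) {v : G → ℝ}
    (hv : ∀ x, ∀ p ∈ P, v (x * p) = v x) :
    (cayleyAdjMatrix S).mulVec v = (∑ s, S.indicator (1 : G → ℝ) s) • v := by
  ext g
  rw [cayleyAdjMatrix_mulVec, Pi.smul_apply, smul_eq_mul, Finset.sum_mul]
  refine Finset.sum_congr rfl fun s _ => ?_
  by_cases hs : s ∈ S
  · rw [hv g s (hSP hs)]
  · simp [hs]

/-! ### The second eigenspace and the main theorem -/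

/-- The functions in the eigenspace of `λ₂` with zero sum. -/
def secondEigenspace {V : Type*} [Fintype V] (A : Matrix V V ℝ) : Submodule ℝ (V → ℝ) where
  carrier := {f | A.mulVec f = secondEigenvalue A • f ∧ f ⬝ᵥ 1 = 0}
  add_mem' := by
    rintro f g ⟨hf, hf1⟩ ⟨hg, hg1⟩
    exact ⟨by rw [Matrix.mulVec_add, hf, hg, smul_add], by rw [add_dotProduct, hf1, hg1, add_zero]⟩
  zero_mem' := ⟨by rw [Matrix.mulVec_zero, smul_zero], zero_dotProduct _⟩
  smul_mem' := by
    rintro c f ⟨hf, hf1⟩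
    exact ⟨by rw [Matrix.mulVec_smul, hf, smul_comm], by rw [smul_dotProduct, hf1, smul_zero]⟩

/-- The adjacency operator of a Cayley graph commutes with left translations. -/
theorem translate_mem_secondEigenspace {G : Type*} [Group G] [Fintype G] {T : Set G} {f : G → ℝ}
    (hf : f ∈ secondEigenspace (cayleyAdjMatrix T)) (g : G) :
    (fun x => f (g * x)) ∈ secondEigenspace (cayleyAdjMatrix T) := by
  refine ⟨?_, ?_⟩
  · ext x
    have h := congrFun hf.1 (g * x)
    rw [cayleyAdjMatrix_mulVec] at h ⊢
    simpa only [mul_assoc, Pi.smul_apply] using h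
  · rw [← hf.2]
    exact Fintype.sum_equiv (Equiv.mulLeft g) _ _ fun x => rfl

/-- There is a function with zero sum that is constant on left cosets of a proper subgroup `P` and
does not vanish on `P`. -/
theorem exists_right_invariant_sum_eq_zero {G : Type*} [Group G] [Fintype G] {P : Subgroup G}
    {t : G} (ht : t ∉ P) :
    ∃ v : G → ℝ, (∀ x, ∀ p ∈ P, v (x * p) = v x) ∧ v ⬝ᵥ 1 = 0 ∧ v 1 ≠ 0 := by
  classical
  -- The indicator of `P` minus that of `tP`.
  refine ⟨fun x => (if x ∈ P then 1 else 0) - (if t⁻¹ * x ∈ P then 1 else 0), ?_, ?_, ?_⟩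
  · intro x p hp
    simp only [← mul_assoc, Subgroup.mul_mem_cancel_right P hp]
  · simp only [dotProduct, Pi.one_apply, mul_one]
    rw [Finset.sum_sub_distrib, sub_eq_zero]
    exact (Fintype.sum_equiv (Equiv.mulLeft t⁻¹) _ _ fun x => rfl).symm
  · simp [one_mem, ht]

/-- If the spectral gap of `Cay(P, S)` is at least four, then some eigenfunction of `λ₂` with zero
sum has nonzero sum over a left coset of `P`. -/
theorem exists_mem_secondEigenspace_sum_coset_ne_zero {Γ : Type*} [Group Γ] [Fintype Γ]
    {S : Set Γ} (hS : S⁻¹ = S) {P : Subgroup Γ} [Fintype P] (hSP : S ⊆ P)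
    (hgap : 4 ≤ spectralGap (cayleyAdjMatrix {s : P | (s : Γ) ∈ S}))
    {t : Γ} (ht : t ∉ P) (htinv : t ≠ t⁻¹) :
    ∃ f ∈ secondEigenspace (cayleyAdjMatrix (S ∪ {t, t⁻¹})), ∃ x, ∑ p : P, f (x * p) ≠ 0 := by
  have hcard : 2 ≤ Fintype.card P := by
    by_contra hlt
    have : Subsingleton P := Fintype.card_le_one_iff_subsingleton.1 (by omega)
    linarith [spectralGap_cayleyAdjMatrix_le_one_of_subsingleton {s : P | (s : Γ) ∈ S}]
  have hcardΓ : 2 ≤ Fintype.card Γ :=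
    hcard.trans (Fintype.card_le_of_injective _ Subtype.val_injective)
  have ht' : t⁻¹ ∉ P := fun h => ht (by simpa using P.inv_mem h)
  set T : Set Γ := S ∪ {t, t⁻¹} with hTdef
  have hT : T⁻¹ = T := by
    rw [hTdef, Set.union_inv, hS, Set.inv_insert, Set.inv_singleton, inv_inv, Set.pair_comm]
  have hS' := inv_preimage_subgroup_eq hS P
  set d := ∑ s, S.indicator (1 : Γ → ℝ) s with hd
  have hfirst : firstEigenvalue (cayleyAdjMatrix {s : P | (s : Γ) ∈ S}) = d := by
    rw [(cayleyAdjMatrix_secondEigenvalue_variational hS' hcard).1, hd]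
    simpa using (sum_indicator_mul_eq_sum_subgroup hSP (fun _ => 1)).symm
  have hsecond : secondEigenvalue (cayleyAdjMatrix {s : P | (s : Γ) ∈ S}) ≤ d - 4 := by
    rw [spectralGap, hfirst] at hgap
    linarith
  have hpair := dotProduct_cayleyAdjMatrix_union_pair (fun h => ht (hSP h))
    (fun h => ht' (hSP h)) htinv
  obtain ⟨-, hray, f, hf0, hf1, hAf⟩ := cayleyAdjMatrix_secondEigenvalue_variational hT hcardΓ
  have hnonneg : ∀ u : Γ → ℝ, 0 ≤ u ⬝ᵥ u := fun u =>
    Finset.sum_nonneg fun i _ => mul_self_nonneg _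
  by_cases hle : secondEigenvalue (cayleyAdjMatrix T) ≤ d - 2
  · obtain ⟨v, hv, hv1, hv0⟩ := exists_right_invariant_sum_eq_zero ht
    refine ⟨v, ⟨?_, hv1⟩, 1, ?_⟩
    -- The Rayleigh quotient of `v` is at least `d - 1 - 1 ≥ λ₂`, so `v` is a maximizer.
    · refine mulVec_eq_smul_of_rayleigh (cayleyAdjMatrix_isSymm hT) (cayleyAdjMatrix_mulVec_one T)
        hray hv1 ?_
      rw [hpair, cayleyAdjMatrix_mulVec_of_right_invariant hSP hv, dotProduct_smul, smul_eq_mul]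
      nlinarith [neg_le_autocorrelation v t, neg_le_autocorrelation v t⁻¹, hnonneg v]
    · have h : ∀ p : P, v (1 * p) = v 1 := fun p => hv 1 p p.2
      simp only [h, Finset.sum_const, Finset.card_univ, nsmul_eq_mul]
      exact mul_ne_zero (by exact_mod_cast Fintype.card_ne_zero) hv0
  · refine ⟨f, ⟨hAf, hf1⟩, ?_⟩
    -- Zero sums on all cosets would force `λ₂ ≤ (d - 4) + 1 + 1`.
    by_contra! hall
    have h1 := dotProduct_cayleyAdjMatrix_le_of_sum_coset_eq_zero hS hSP hcard hall
    have h2 := hpair f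
    rw [hAf, dotProduct_smul, smul_eq_mul] at h2
    have hpos : 0 < f ⬝ᵥ f :=
      lt_of_le_of_ne (hnonneg f) fun h => hf0 (dotProduct_self_eq_zero.1 h.symm)
    push Not at hle
    nlinarith [autocorrelation_le f t, autocorrelation_le f t⁻¹]

theorem theorem2p1 {Γ : Type*} [Group Γ] [Finite Γ] (S : Set Γ) (hS : S⁻¹ = S)
    (P : Subgroup Γ) (hP : P = Subgroup.closure S)
    (hgap : 4 ≤ spectralGap (cayleyAdjMatrix {s : P | (s : Γ) ∈ S}))
    (hcosets : Nat.card (DoubleCoset.Quotient (P : Set Γ) (P : Set Γ)) = 2)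
    (t : Γ) (ht : t ∉ P) (htinv : t ≠ t⁻¹) :
    (Nat.card Γ : ℝ) / (Nat.card P : ℝ) - 1 ≤
      (secondEigenvalueMultiplicity (cayleyAdjMatrix (S ∪ {t, t⁻¹})) : ℝ) := by
  have := Fintype.ofFinite Γ
  have := Fintype.ofFinite P
  have hSP : S ⊆ P := hP ▸ Subgroup.subset_closure
  obtain ⟨f, hf, x, hx⟩ := exists_mem_secondEigenspace_sum_coset_ne_zero hS hSP hgap ht htinv
  have h1 := index_le_finrank_add_one hcosets ht
    (fun _ hf g => translate_mem_secondEigenspace hf g)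
    (fun f hf => by simpa [dotProduct] using hf.2) hf hx
  have h2 := finrank_le_secondEigenvalueMultiplicity
    (W := secondEigenspace (cayleyAdjMatrix (S ∪ {t, t⁻¹}))) fun f hf => hf.1
  have h3 : (Nat.card Γ : ℝ) / (Nat.card P : ℝ) = P.index := by
    rw [← P.card_mul_index, Nat.cast_mul,
      mul_div_cancel_left₀ _ (by exact_mod_cast Nat.card_pos.ne')]
  rw [h3, sub_le_iff_le_add]
  exact_mod_cast h1.trans (Nat.add_le_add_right h2 1)
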